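/- Let $\mathbb{D}=\{z\in\mathbb{C}:|z|<1\}$. Let $\mathcal{H}$ be the class of locally univalent and sense-preserving harmonic mappings $f=h+\overline{g}$ on $\mathbb{D}$, with $h,g$ analytic in $\mathbb{D}$ and $h(0)=h'(0)-1=0$; thus $|h'|^2-|g'|^2>0$ in $\mathbb{D}$. The dilatation of $f$ is $\omega=g'/h'$. A mapping $f$ is convex in the direction $\gamma\in\mathbb{R}$ if $f(\mathbb{D})$ is a domain whose intersection with every line parallel to the line joining the origin to $e^{i\gamma}$ is connected (or empty). For $\mu,\nu\in\mathbb{R}$ let $$\psi_{\mu,\nu}(z)=\frac{1}{1-2ze^{i\mu}\cos\nu+z^2e^{2i\mu}},\qquad z\in\mathbb{D}.$$ **Theorem.** Let $\mu,\nu\in\mathbb{R}$. For $k=1,2$, let $f_k=h_k+\overline{g_k}\in\mathcal{H}$ satisfy $$h_k(z)+e^{-2i\mu}g_k(z)=\int_0^z\psi_{\mu,\nu}(\xi)\,d\xi,\qquad z\in\mathbb{D},$$ and let the dilatation $\omega_k$ of $f_k$ satisfy $|\omega_k(z)|<\alpha_k$ for all $z\in\mathbb{D}$, where $\alpha_1,\alpha_2$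 are real numbers that are not both greater than $1$. Then the mapping $\mathcal{F}=\eta f_1+(1-\eta)f_2$ is univalent in $\mathbb{D}$ and convex in the direction $-\mu$ for every $\eta\in\mathbb{C}$ with $$|\eta|\le\frac{(1-\alpha_1)(1-\alpha_2)}{2(\alpha_1+\alpha_2)}$$ that satisfies either of the following conditions: (i) $0\le\operatorname{Re}\eta\le1$; (ii) $-1\le\operatorname{Re}\eta\le1$, provided that $\alpha_1\le1/5$ and $\alpha_2\le1/7$. In particular, if $\alpha_1\le 1/5$ and $\alpha_2\le 1/7$, then $\mathcal{F}$ is univalent in $\mathbb{D}$ and convex in the direction $-\mu$ for every $\eta\in\mathbb{C}$ with $|\eta|\le1$. -/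

import Mathlib

namespace HarmonicMapping

/-- The open unit disk of the complex plane. -/
abbrev disk : Set ℂ := Metric.ball (0 : ℂ) 1

/-- The Jacobian `|h'|² - |g'|²` of the harmonic mapping `h + conj g`. -/
noncomputable def jacobian (h g : ℂ → ℂ) (z : ℂ) : ℝ :=
  ‖deriv h z‖ ^ 2 - ‖deriv g z‖ ^ 2

/-- The dilatation `g' / h'` of the harmonic mapping `h + conj g`. -/
noncomputable def dilatation (h g : ℂ → ℂ) (z : ℂ) : ℂ :=
  deriv g z / deriv h z

/-- `f` is locally univalent on the unit disk: injective near every point of the disk. -/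
def LocallyUnivalent (f : ℂ → ℂ) : Prop :=
  ∀ z ∈ disk, ∃ U ∈ nhds z, Set.InjOn f U

/-- The class of locally univalent and sense-preserving harmonic mappings `f = h + conj g` on the
unit disk, with analytic part `h` and co-analytic part `g`, normalized by `h 0 = 0`, `h' 0 = 1`. -/
structure IsNormalizedHarmonic (f h g : ℂ → ℂ) : Prop where
  analytic_h : DifferentiableOn ℂ h disk
  analytic_g : DifferentiableOn ℂ g disk
  decomposition : ∀ z ∈ disk, f z = h z + starRingEnd ℂ (g z)
  locallyUnivalent : LocallyUnivalent f
  sensePreserving : ∀ z ∈ disk, 0 < jacobian h g z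
  map_zero : h 0 = 0
  deriv_zero : deriv h 0 = 1

/-- The function `ψ_{μ,ν}(z) = (1 - 2 z e^{iμ} cos ν + z² e^{2iμ})⁻¹`. -/
noncomputable def psi (μ ν : ℝ) (z : ℂ) : ℂ :=
  (1 - 2 * z * Complex.exp (μ * Complex.I) * (Real.cos ν : ℂ)
    + z ^ 2 * Complex.exp (2 * μ * Complex.I))⁻¹

/-- The complex line integral of `F` from `0` to `z` along the straight segment. -/
noncomputable def integralFromZero (F : ℂ → ℂ) (z : ℂ) : ℂ :=
  ∫ t in (0 : ℝ)..1, F (t * z) * z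

/-- The line through `w` parallel to the line joining the origin to `e^{iγ}`. -/
def lineInDirection (γ : ℝ) (w : ℂ) : Set ℂ :=
  {p | ∃ t : ℝ, p = w + t * Complex.exp (γ * Complex.I)}

/-- `Ω` is a domain that is convex in the direction `γ`: every line parallel to the line joining
the origin to `e^{iγ}` has connected (possibly empty) intersection with `Ω`. -/
structure IsConvexInDirection (Ω : Set ℂ) (γ : ℝ) : Prop where
  isOpen : IsOpen Ω
  isConnected : IsConnected Ω
  isPreconnected_inter : ∀ w : ℂ, IsPreconnected (Ω ∩ lineInDirection γ w)

/-- `f` is univalent on the unit disk and convex in the direction `γ`. -/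
def UnivalentConvexInDirection (f : ℂ → ℂ) (γ : ℝ) : Prop :=
  Set.InjOn f disk ∧ IsConvexInDirection (f '' disk) γ

end HarmonicMapping

namespace HarmonicMapping

open Set Metric Filter Topology

/-! Use w = e^{iμ}∫ψ, up to a constant, as coordinate: the disk becomes a vertical strip or
half-plane. The maps e^{iμ}f_k become shears H + conj G with H + G = w + C and H - G = q_k, and q_k'
is the Cayley transform (1 - ω)/(1 + ω) of a rotated dilatation. Thus q_k' takes values in a convex
set, `cayleyDisk α_k`. The rotation by e^{iμ} makes the direction -μ horizontal.

Univalence: over a convex domain, difference quotients of q_k stay in the convex set containing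
q_k'. The bound on |η| is what makes the analytic part of the combination dominate the co-analytic
part for every pair of values A₁, A₂ in the two sets (`norm_lt_of_mem_cayleyDisk`). Hence |ΔG| <
|ΔH| between distinct points. The same inequality for derivatives makes the image open.

Convexity: the imaginary part of the combination is Im Q with Q = Re η · q₁ + (1 - Re η) q₂, and Re
Q' > 0. So Im Q increases strictly along vertical lines, and a level set is a graph over the set of
abscissae that it meets. That this set is an interval is the delicate point
(`exists_le_im_of_mem_Icc`). A Harnack-type estimate, uniform in height, shows that if Im Q stayed
below c on a line between two lines reaching c, then Re Q' would be bounded below high up on it,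
forcing Im Q to be unbounded there. -/

/-! ### Tools from complex analysis -/

/-- Schwarz–Pick estimate at the centre of a disk for functions with positive real part. -/
theorem norm_deriv_le_of_re_pos {P : ℂ → ℂ} {z : ℂ} {R : ℝ} (hR : 0 < R)
    (hP : DifferentiableOn ℂ P (ball z R)) (hpos : ∀ w ∈ ball z R, 0 < (P w).re) :
    ‖deriv P z‖ ≤ 2 * (P z).re / R := by
  have hz : z ∈ ball z R := mem_ball_self hR
  have hPz := hpos z hz
  have hne : ∀ w ∈ ball z R, P w + starRingEnd ℂ (P z) ≠ 0 := fun w hw h => by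
    have := congrArg Complex.re h
    simp at this
    linarith [hpos w hw]
  -- Cayley transform of the right half-plane onto the unit disk sending P z to 0; its composite
  -- with P has derivative P'(z) / (2 Re P z) at z.
  have hd : DifferentiableOn ℂ
      (fun w => (P w - P z) / (P w + starRingEnd ℂ (P z))) (ball z R) :=
    (hP.sub_const _).div (hP.add_const _) hne
  have hmaps : MapsTo (fun w => (P w - P z) / (P w + starRingEnd ℂ (P z))) (ball z R)
      (closedBall ((P z - P z) / (P z + starRingEnd ℂ (P z))) 1) := by
    intro w hw
    rw [sub_self, zero_div, mem_closedBall_zero_iff, norm_div]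
    refine div_le_one_of_le₀ ?_ (norm_nonneg _)
    rw [← sq_le_sq₀ (norm_nonneg _) (norm_nonneg _), Complex.sq_norm, Complex.sq_norm,
      Complex.normSq_apply, Complex.normSq_apply]
    simp
    nlinarith [mul_pos (hpos w hw) hPz]
  have hS := Complex.norm_deriv_le_div_of_mapsTo_ball hd hmaps hR
  have hPd : HasDerivAt P (deriv P z) z :=
    (hP.differentiableAt (isOpen_ball.mem_nhds hz)).hasDerivAt
  have hder := ((hPd.sub_const (P z)).div (hPd.add_const (starRingEnd ℂ (P z))) (hne z hz)).deriv
  have hsum : P z + starRingEnd ℂ (P z) = ((2 * (P z).re : ℝ) : ℂ) := Complex.add_conj _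
  have h2 : ((2 * (P z).re : ℝ) : ℂ) ≠ 0 := by exact_mod_cast (by positivity)
  have hS' : ‖deriv P z / ((2 * (P z).re : ℝ) : ℂ)‖ ≤ 1 / R := by
    refine le_trans (le_of_eq ?_) hS
    congr 1
    refine Eq.trans ?_ hder.symm
    rw [hsum]
    field_simp
    ring
  rw [norm_div, Complex.norm_real, Real.norm_of_nonneg (by positivity),
    div_le_iff₀ (by positivity)] at hS'
  calc _ ≤ _ := hS'
    _ = _ := by ring

/-- The slope of a holomorphic function on a convex set is an average of its derivative. -/
theorem exists_slope_mem {S K : Set ℂ} (hS : IsOpen S) (hSc : Convex ℝ S) (hK : Convex ℝ K)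
    (hKo : IsOpen K) {q : ℂ → ℂ} (hq : DifferentiableOn ℂ q S) (hqK : ∀ w ∈ S, deriv q w ∈ K)
    {w w' : ℂ} (hw : w ∈ S) (hw' : w' ∈ S) :
    ∃ A ∈ K, q w' - q w = (w' - w) * A := by
  rcases eq_or_ne w w' with rfl | hne
  · exact ⟨deriv q w, hqK w hw, by simp⟩
  have hδ : w' - w ≠ 0 := sub_ne_zero.mpr hne.symm
  refine ⟨(q w' - q w) / (w' - w), ?_, by field_simp⟩
  -- Separate the slope from K by a real functional f. Along the segment, f of the derivative is
  -- always smaller than f of the slope, against the mean value theorem.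
  by_contra hA
  obtain ⟨f, hf⟩ := geometric_hahn_banach_open_point hK hKo hA
  have hseg : ∀ t ∈ Icc (0 : ℝ) 1, w + t * (w' - w) ∈ S := fun t ht => by
    simpa using hSc.add_smul_sub_mem hw hw' ht
  have hder : ∀ t ∈ Icc (0 : ℝ) 1,
      HasDerivAt (fun t : ℝ => f ((q (w + t * (w' - w)) - q w) / (w' - w)))
        (f (deriv q (w + t * (w' - w)))) t := fun t ht => by
    have hq' := (hq.differentiableAt (hS.mem_nhds (hseg t ht))).hasDerivAt
    have hline : HasDerivAt (fun t : ℝ => w + t * (w' - w)) (w' - w) t := by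
      simpa using ((Complex.ofRealCLM.hasDerivAt (x := t)).mul_const (w' - w)).const_add w
    have h1 := ((hq'.comp_of_eq t hline rfl).sub_const (q w)).div_const (w' - w)
    rw [mul_div_cancel_right₀ _ hδ] at h1
    exact f.hasFDerivAt.comp_hasDerivAt t h1
  obtain ⟨t, ht, h⟩ := exists_hasDerivAt_eq_slope _ _ zero_lt_one
    (fun t ht => (hder t ht).continuousAt.continuousWithinAt)
    (fun t ht => hder t (Ioo_subset_Icc_self ht))
  have := hf _ (hqK _ (hseg t (Ioo_subset_Icc_self ht)))
  simp at h
  linarith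

/-- A sense-preserving harmonic mapping is open. -/
theorem isOpen_image_add_conj {S : Set ℂ} (hS : IsOpen S) {H G : ℂ → ℂ}
    (hH : DifferentiableOn ℂ H S) (hG : DifferentiableOn ℂ G S)
    (hlt : ∀ w ∈ S, ‖deriv G w‖ < ‖deriv H w‖) :
    IsOpen ((fun w => H w + starRingEnd ℂ (G w)) '' S) := by
  rw [isOpen_iff_mem_nhds]
  rintro _ ⟨w, hw, rfl⟩
  have hHs : HasStrictDerivAt H (deriv H w) w :=
    (hH.analyticAt (hS.mem_nhds hw)).hasStrictDerivAt
  have hGs : HasStrictDerivAt G (deriv G w) w :=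
    (hG.analyticAt (hS.mem_nhds hw)).hasStrictDerivAt
  have hstrict := hHs.complexToReal_fderiv.add
    (Complex.conjCLE.toContinuousLinearMap.hasStrictFDerivAt.comp w hGs.complexToReal_fderiv)
  -- The real differential v ↦ H'v + conj(G'v) is injective because |G'| < |H'|, hence surjective in
  -- finite dimension.
  have hsurj := hstrict.map_nhds_eq_of_surj (by
    rw [LinearMap.range_eq_top]
    refine LinearMap.injective_iff_surjective.mp ((injective_iff_map_eq_zero _).mpr fun v hv => ?_)
    by_contra hv0
    have h1 : deriv H w * v = -starRingEnd ℂ (deriv G w * v) := by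
      rw [eq_neg_iff_add_eq_zero]
      simpa using hv
    have h2 := congrArg norm h1
    rw [norm_neg, RCLike.norm_conj, norm_mul, norm_mul] at h2
    have := mul_lt_mul_of_pos_right (hlt w hw) (norm_pos_iff.mpr hv0)
    linarith)
  have := image_mem_map (m := fun w => H w + starRingEnd ℂ (G w)) (hS.mem_nhds hw)
  exact hsurj ▸ this

/-! ### Level sets of Im Q in a vertical strip -/

theorem isOpen_strip {I : Set ℝ} (hI : IsOpen I) : IsOpen (Complex.re ⁻¹' I) :=
  hI.preimage Complex.continuous_re

theorem convex_strip {I : Set ℝ} (hIc : I.OrdConnected) : Convex ℝ (Complex.re ⁻¹' I) :=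
  hIc.convex.linear_preimage Complex.reLm

/-- On a vertical strip, a holomorphic function whose derivative has positive real part is
approximated by its linearization, uniformly relative to the real part of the derivative. -/
theorem exists_norm_sub_linearization_le {I : Set ℝ} (hI : IsOpen I) (hIc : I.OrdConnected)
    {Q : ℂ → ℂ} (hQ : DifferentiableOn ℂ Q (Complex.re ⁻¹' I))
    (hpos : ∀ w ∈ Complex.re ⁻¹' I, 0 < (deriv Q w).re) {a b : ℝ} (ha : a ∈ I) (hb : b ∈ I) :
    ∃ K > 0, ∀ z w : ℂ, z.re ∈ Icc a b → w.re ∈ Icc a b → z.im = w.im →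
      ‖Q w - Q z - deriv Q z * (w - z)‖ ≤ K * (deriv Q z).re := by
  have hS := isOpen_strip hI
  have hP : DifferentiableOn ℂ (deriv Q) (Complex.re ⁻¹' I) := hQ.deriv hS
  -- One radius R serves all heights, since the strip is invariant under vertical translation; hence
  -- K does not depend on the height.
  obtain ⟨R, hR, hRI⟩ := isCompact_Icc.exists_thickening_subset_open hI (hIc.out ha hb)
  have hball : ∀ z : ℂ, z.re ∈ Icc a b → ball z R ⊆ Complex.re ⁻¹' I := fun z hz w hw => by
    refine hRI (mem_thickening_iff.mpr ⟨z.re, hz, ?_⟩)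
    rw [mem_ball, Complex.dist_eq] at hw
    rw [Real.dist_eq, ← Complex.sub_re]
    exact (Complex.abs_re_le_norm _).trans_lt hw
  have hmem : ∀ z : ℂ, z.re ∈ Icc a b → z ∈ Complex.re ⁻¹' I := fun z hz =>
    hball z hz (mem_ball_self hR)
  set L : ℝ := |b - a| + 1 with hL
  have hLpos : 0 < L := by positivity
  set k : ℝ := 2 * L / R with hk
  have hkpos : 0 < k := by positivity
  have hseg : ∀ z w : ℂ, z.re ∈ Icc a b → w.re ∈ Icc a b → ∀ t ∈ Icc (0 : ℝ) 1,
      (z + t * (w - z)).re ∈ Icc a b := fun z w hz hw t ht => by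
    simpa using (convex_Icc a b).add_smul_sub_mem hz hw ht
  have hlen : ∀ z w : ℂ, z.re ∈ Icc a b → w.re ∈ Icc a b → z.im = w.im → ‖w - z‖ ≤ L := by
    intro z w hz hw him
    have : w - z = ((w.re - z.re : ℝ) : ℂ) := by
      apply Complex.ext <;> simp [him]
    rw [this, Complex.norm_real, Real.norm_eq_abs]
    have := le_abs_self (b - a)
    rw [abs_le]
    constructor <;> linarith [hz.1, hz.2, hw.1, hw.2]
  have hvar : ∀ z w : ℂ, z.re ∈ Icc a b → w.re ∈ Icc a b → z.im = w.im →
      ‖deriv Q w - deriv Q z‖ ≤ Real.exp k * (deriv Q z).re := by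
    intro z w hz hw him
    have hzpos := hpos z (hmem z hz)
    have hline : ∀ t : ℝ, HasDerivAt (fun t : ℝ => z + t * (w - z)) (w - z) t := fun t => by
      simpa using ((Complex.ofRealCLM.hasDerivAt (x := t)).mul_const (w - z)).const_add z
    have hder : ∀ t ∈ Icc (0 : ℝ) 1, HasDerivAt
        (fun t : ℝ => deriv Q (z + t * (w - z)) - deriv Q z)
        (deriv (deriv Q) (z + t * (w - z)) * (w - z)) t := fun t ht =>
      (((hP.differentiableAt (hS.mem_nhds (hmem _ (hseg z w hz hw t ht)))).hasDerivAt).comp_of_eq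
        t (hline t) rfl).sub_const _
    -- Schwarz–Pick bounds |Q''| by a multiple of Re Q', so Grönwall controls the variation of Q'
    -- along a horizontal segment by its real part at the start.
    have hg := norm_le_gronwallBound_of_norm_deriv_right_le (δ := 0) (K := k)
      (ε := k * (deriv Q z).re) (a := 0) (b := 1)
      (fun t ht => (hder t ht).continuousAt.continuousWithinAt)
      (fun t ht => (hder t (Ico_subset_Icc_self ht)).hasDerivWithinAt)
      (by simp) (fun t ht => by
        have hr := hseg z w hz hw t (Ico_subset_Icc_self ht)
        have hsp := norm_deriv_le_of_re_pos hR (hP.mono (hball _ hr))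
          (fun v hv => hpos v (hball _ hr hv))
        have hre : (deriv Q (z + t * (w - z))).re ≤
            ‖deriv Q (z + t * (w - z)) - deriv Q z‖ + (deriv Q z).re := by
          have := Complex.re_le_norm (deriv Q (z + t * (w - z)) - deriv Q z)
          rw [Complex.sub_re] at this
          linarith
        rw [norm_mul]
        calc _ ≤ 2 * (deriv Q (z + t * (w - z))).re / R * L := by
              refine mul_le_mul hsp (hlen z w hz hw him) (norm_nonneg _) ?_
              exact (norm_nonneg _).trans hsp
          _ = k * (deriv Q (z + t * (w - z))).re := by rw [hk]; ring
          _ ≤ k * (‖deriv Q (z + t * (w - z)) - deriv Q z‖ + (deriv Q z).re) := by gcongr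
          _ = _ := by ring) 1 (right_mem_Icc.mpr zero_le_one)
    rw [gronwallBound_of_K_ne_0 hkpos.ne'] at hg
    simp only [Complex.ofReal_one, one_mul, add_sub_cancel, sub_zero, mul_one, zero_mul,
      zero_add, mul_div_cancel_left₀ _ hkpos.ne'] at hg
    nlinarith
  refine ⟨Real.exp k * L, by positivity, fun z w hz hw him => ?_⟩
  have hzw : ∀ v ∈ segment ℝ z w, v.re ∈ Icc a b ∧ z.im = v.im := by
    rw [segment_eq_image']
    rintro _ ⟨t, ht, rfl⟩
    refine ⟨by simpa using hseg z w hz hw t ht, by simp [him]⟩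
  have := (convex_segment z w).norm_image_sub_le_of_norm_hasDerivWithin_le
    (f := fun v => Q v - deriv Q z * v) (f' := fun v => deriv Q v - deriv Q z)
    (C := Real.exp k * (deriv Q z).re)
    (fun v hv => by
      have := ((hQ.differentiableAt (hS.mem_nhds (hmem v (hzw v hv).1))).hasDerivAt.sub
        ((hasDerivAt_id v).const_mul (deriv Q z))).hasDerivWithinAt (s := segment ℝ z w)
      simp only [mul_one] at this
      exact this)
    (fun v hv => hvar z v hz (hzw v hv).1 (hzw v hv).2)
    (left_mem_segment ℝ z w) (right_mem_segment ℝ z w)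
  calc _ = ‖Q w - deriv Q z * w - (Q z - deriv Q z * z)‖ := by congr 1; ring
    _ ≤ _ := this
    _ ≤ Real.exp k * (deriv Q z).re * L :=
      mul_le_mul_of_nonneg_left (hlen z w hz hw him)
        (mul_nonneg (Real.exp_pos k).le (hpos z (hmem z hz)).le)
    _ = _ := by ring

theorem hasDerivAt_im_vertical {Q : ℂ → ℂ} {x y : ℝ}
    (hQ : DifferentiableAt ℂ Q (x + y * Complex.I)) :
    HasDerivAt (fun y : ℝ => (Q (x + y * Complex.I)).im)
      (deriv Q (x + y * Complex.I)).re y := by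
  have hline : HasDerivAt (fun y : ℝ => (x : ℂ) + y * Complex.I) Complex.I y := by
    simpa using ((Complex.ofRealCLM.hasDerivAt (x := y)).mul_const Complex.I).const_add (x : ℂ)
  have := Complex.imCLM.hasFDerivAt.comp_hasDerivAt y
    (hQ.hasDerivAt.comp_of_eq y hline rfl)
  rw [Complex.imCLM_apply, Complex.mul_I_im] at this
  exact this

theorem strictMono_im_vertical {I : Set ℝ} (hI : IsOpen I) {Q : ℂ → ℂ}
    (hQ : DifferentiableOn ℂ Q (Complex.re ⁻¹' I))
    (hpos : ∀ w ∈ Complex.re ⁻¹' I, 0 < (deriv Q w).re) {x : ℝ} (hx : x ∈ I) :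
    StrictMono fun y : ℝ => (Q (x + y * Complex.I)).im := by
  have hmem : ∀ y : ℝ, (x + y * Complex.I : ℂ) ∈ Complex.re ⁻¹' I := fun y => by simpa using hx
  refine strictMono_of_deriv_pos fun y => ?_
  rw [(hasDerivAt_im_vertical (hQ.differentiableAt ((isOpen_strip hI).mem_nhds (hmem y)))).deriv]
  exact hpos _ (hmem y)

/-- If the level `c` of `Im Q` is attained on two vertical lines of a strip, then `Im Q` is
somewhere at least `c` on every vertical line in between. -/
theorem exists_le_im_of_mem_Icc {I : Set ℝ} (hI : IsOpen I) (hIc : I.OrdConnected)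
    {Q : ℂ → ℂ} (hQ : DifferentiableOn ℂ Q (Complex.re ⁻¹' I))
    (hpos : ∀ w ∈ Complex.re ⁻¹' I, 0 < (deriv Q w).re) {a b x c ya yb : ℝ}
    (ha : a ∈ I) (hb : b ∈ I) (hx : x ∈ Icc a b)
    (hya : c ≤ (Q (a + ya * Complex.I)).im) (hyb : c ≤ (Q (b + yb * Complex.I)).im) :
    ∃ y : ℝ, c ≤ (Q (x + y * Complex.I)).im := by
  by_contra! hlt
  have hxI : x ∈ I := hIc.out ha hb hx
  have hmono := fun {s : ℝ} (hs : s ∈ I) => strictMono_im_vertical hI hQ hpos hs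
  obtain ⟨K, hK, hest⟩ := exists_norm_sub_linearization_le hI hIc hQ hpos ha hb
  set Y : ℝ := max ya yb + 1 with hY
  set ε : ℝ := min ((Q (a + Y * Complex.I)).im - c) ((Q (b + Y * Complex.I)).im - c) with hε
  have hεpos : 0 < ε := lt_min
    (sub_pos.mpr (hya.trans_lt (hmono ha (by linarith [le_max_left ya yb]))))
    (sub_pos.mpr (hyb.trans_lt (hmono hb (by linarith [le_max_right ya yb]))))
  have hlow : ∀ y, Y ≤ y → ε / K ≤ (deriv Q (x + y * Complex.I)).re := by
    intro y hy
    rw [div_le_iff₀ hK]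
    have hkey : ∀ s ∈ Icc a b, (Q (s + y * Complex.I)).im ≤ (Q (x + y * Complex.I)).im
        + (deriv Q (x + y * Complex.I)).im * (s - x) + K * (deriv Q (x + y * Complex.I)).re := by
      intro s hs
      have h1 := hest (x + y * Complex.I) (s + y * Complex.I) (by simpa using hx)
        (by simpa using hs) (by simp)
      have h2 := (Complex.im_le_norm _).trans h1
      simp at h2
      linarith
    have hA := hkey a ⟨le_rfl, hx.1.trans hx.2⟩
    have hB := hkey b ⟨hx.1.trans hx.2, le_rfl⟩
    have hmA := (hmono ha).monotone hy
    have hmB := (hmono hb).monotone hy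
    have hεA : ε ≤ _ := min_le_left _ _
    have hεB : ε ≤ _ := min_le_right _ _
    have hxy := hlt y
    -- Use the endpoint a or b at which the linear term Im Q' · (s - x) is nonpositive.
    rcases le_total 0 (deriv Q (x + y * Complex.I)).im with h | h
    · nlinarith [mul_nonneg h (sub_nonneg.mpr hx.1)]
    · nlinarith [mul_nonneg (neg_nonneg.mpr h) (sub_nonneg.mpr hx.2)]
  have hder : ∀ y : ℝ, HasDerivAt (fun y : ℝ => (Q (x + y * Complex.I)).im)
      (deriv Q (x + y * Complex.I)).re y := fun y =>
    hasDerivAt_im_vertical (hQ.differentiableAt ((isOpen_strip hI).mem_nhds (by simpa using hxI)))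
  set u : ℝ → ℝ := fun y => (Q (x + y * Complex.I)).im with hu
  -- The height at which growth at rate ε / K from Y must have reached c.
  set y₁ : ℝ := Y + (c - u Y) / (ε / K) with hy₁
  have hεK : 0 < ε / K := by positivity
  have hYy : Y ≤ y₁ := by
    have : 0 ≤ (c - u Y) / (ε / K) := div_nonneg (sub_nonneg.mpr (hlt Y).le) hεK.le
    linarith
  have hgrow := (convex_Ici Y).mul_sub_le_image_sub_of_le_deriv (f := u) (C := ε / K)
    (fun y _ => (hder y).continuousAt.continuousWithinAt)
    (fun y _ => (hder y).differentiableAt.differentiableWithinAt)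
    (fun y hy => by
      rw [interior_Ici] at hy
      rw [(hder y).deriv]
      exact hlow y hy.le) Y self_mem_Ici y₁ hYy hYy
  rw [hy₁, add_sub_cancel_left, mul_div_cancel₀ _ hεK.ne', ← hy₁] at hgrow
  have := hlt y₁
  simp only [hu] at hgrow
  linarith

/-- The set of vertical lines of a strip that meet the level set `Im Q = c` is convex. -/
theorem ordConnected_level {I : Set ℝ} (hI : IsOpen I) (hIc : I.OrdConnected)
    {Q : ℂ → ℂ} (hQ : DifferentiableOn ℂ Q (Complex.re ⁻¹' I))
    (hpos : ∀ w ∈ Complex.re ⁻¹' I, 0 < (deriv Q w).re) (c : ℝ) :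
    {x : ℝ | x ∈ I ∧ ∃ y : ℝ, (Q (x + y * Complex.I)).im = c}.OrdConnected := by
  refine ⟨?_⟩
  rintro a ⟨ha, ya, hya⟩ b ⟨hb, yb, hyb⟩ x hx
  have hxI : x ∈ I := hIc.out ha hb hx
  refine ⟨hxI, ?_⟩
  obtain ⟨y₁, hy₁⟩ := exists_le_im_of_mem_Icc hI hIc hQ hpos ha hb hx hya.ge hyb.ge
  obtain ⟨y₂, hy₂⟩ : ∃ y : ℝ, (Q (x + y * Complex.I)).im ≤ c := by
    -- The half-turn w ↦ -w with Q replaced by -Q(-w) keeps the derivative condition and reverses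
    -- the inequality.
    have hI' : IsOpen (-I) := hI.neg
    have hIc' : (-I).OrdConnected :=
      ⟨fun s hs t ht r hr => hIc.out ht hs ⟨neg_le_neg hr.2, neg_le_neg hr.1⟩⟩
    have hmaps : MapsTo (fun w : ℂ => -w) (Complex.re ⁻¹' (-I)) (Complex.re ⁻¹' I) :=
      fun w hw => by simpa using hw
    have hd : ∀ w ∈ Complex.re ⁻¹' (-I),
        HasDerivAt (fun w => -Q (-w)) (deriv Q (-w)) w := fun w hw => by
      have := (((hQ.differentiableAt ((isOpen_strip hI).mem_nhds (hmaps hw))).hasDerivAt).comp_of_eq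
        w (hasDerivAt_neg w) rfl).neg
      rw [mul_neg_one, neg_neg] at this
      exact this
    obtain ⟨y, hy⟩ := exists_le_im_of_mem_Icc (Q := fun w => -Q (-w)) (a := -b) (b := -a) (x := -x)
      (c := -c) (ya := -yb) (yb := -ya) hI' hIc'
      (fun w hw => (hd w hw).differentiableAt.differentiableWithinAt)
      (fun w hw => by rw [(hd w hw).deriv]; exact hpos _ (hmaps hw))
      (by simpa using hb) (by simpa using ha) ⟨neg_le_neg hx.2, neg_le_neg hx.1⟩
      (by simp [← hyb, add_comm]) (by simp [← hya, add_comm])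
    refine ⟨-y, ?_⟩
    have : -((-x : ℝ) + y * Complex.I : ℂ) = x + (-y : ℝ) * Complex.I := by push_cast; ring
    rw [this] at hy
    simpa using hy
  have hcont : Continuous fun y : ℝ => (Q (x + y * Complex.I)).im :=
    continuous_iff_continuousAt.mpr fun y => (hasDerivAt_im_vertical
      (hQ.differentiableAt ((isOpen_strip hI).mem_nhds (by simpa using hxI)))).continuousAt
  exact mem_range_of_exists_le_of_exists_ge hcont ⟨y₂, hy₂⟩ ⟨y₁, hy₁⟩

/-- In a vertical strip, the level sets of `Im Q` are connected. -/
theorem isPreconnected_level {I : Set ℝ} (hI : IsOpen I) (hIc : I.OrdConnected)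
    {Q : ℂ → ℂ} (hQ : DifferentiableOn ℂ Q (Complex.re ⁻¹' I))
    (hpos : ∀ w ∈ Complex.re ⁻¹' I, 0 < (deriv Q w).re) (c : ℝ) :
    IsPreconnected {w : ℂ | w.re ∈ I ∧ (Q w).im = c} := by
  set J : Set ℝ := {x : ℝ | x ∈ I ∧ ∃ y : ℝ, (Q (x + y * Complex.I)).im = c} with hJ
  have hmono := fun {s : ℝ} (hs : s ∈ I) => strictMono_im_vertical hI hQ hpos hs
  have hchoice : ∀ x : ℝ, ∃ y : ℝ, x ∈ J → (Q (x + y * Complex.I)).im = c := fun x => by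
    by_cases h : x ∈ J
    · exact ⟨h.2.choose, fun _ => h.2.choose_spec⟩
    · exact ⟨0, fun h' => absurd h' h⟩
  choose Y hY using hchoice
  have hcontx : ∀ x ∈ I, ∀ y : ℝ, ContinuousAt (fun x : ℝ => (Q (x + y * Complex.I)).im) x := by
    intro x hx y
    have hq : ContinuousAt Q (x + y * Complex.I) :=
      (hQ.differentiableAt ((isOpen_strip hI).mem_nhds (by simpa using hx))).continuousAt
    exact Complex.continuous_im.continuousAt.comp
      (hq.comp_of_eq (f := fun x : ℝ => (x + y * Complex.I : ℂ)) (by fun_prop) rfl)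
  -- Q at a height just below or above the graph stays on its side of c for nearby abscissae, and
  -- vertical monotonicity turns this into bounds on Y.
  have hYc : ContinuousOn Y J := by
    intro x hx
    rw [ContinuousWithinAt, tendsto_order]
    refine ⟨fun y hy => ?_, fun y hy => ?_⟩
    · have h1 : (Q (x + y * Complex.I)).im < c := hY x hx ▸ hmono hx.1 hy
      filter_upwards [mem_nhdsWithin_of_mem_nhds ((hcontx x hx.1 y).eventually_lt_const h1),
        self_mem_nhdsWithin] with x' hx' hxJ
      rw [← hY x' hxJ] at hx'
      exact (hmono hxJ.1).lt_iff_lt.mp hx'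
    · have h1 : c < (Q (x + y * Complex.I)).im := hY x hx ▸ hmono hx.1 hy
      filter_upwards [mem_nhdsWithin_of_mem_nhds ((hcontx x hx.1 y).eventually_const_lt h1),
        self_mem_nhdsWithin] with x' hx' hxJ
      rw [← hY x' hxJ] at hx'
      exact (hmono hxJ.1).lt_iff_lt.mp hx'
  have himage : {w : ℂ | w.re ∈ I ∧ (Q w).im = c} =
      (fun x : ℝ => (x + Y x * Complex.I : ℂ)) '' J := by
    ext w
    constructor
    · rintro ⟨hw, hc⟩
      have hwJ : w.re ∈ J := ⟨hw, w.im, by rwa [Complex.re_add_im]⟩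
      refine ⟨w.re, hwJ, ?_⟩
      have : Y w.re = w.im := (hmono hw).injective (by
        simp only [hY _ hwJ, Complex.re_add_im, hc])
      simp only [this, Complex.re_add_im]
    · rintro ⟨x, hx, rfl⟩
      exact ⟨by simpa using hx.1, hY x hx⟩
  rw [himage]
  refine (ordConnected_level hI hIc hQ hpos c).isPreconnected.image _ ?_
  exact Complex.continuous_ofReal.continuousOn.add
    ((Complex.continuous_ofReal.comp_continuousOn hYc).mul continuousOn_const)

/-! ### Combinations of shears over a strip -/

/-- The harmonic mapping `h + conj g` with `h + g = w + C` and `h - g = q`. -/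
noncomputable def shear (C : ℂ) (q : ℂ → ℂ) (w : ℂ) : ℂ :=
  (w + C + q w) / 2 + starRingEnd ℂ ((w + C - q w) / 2)

/-- A linear combination of two shears of the same strip is univalent and convex in the horizontal
direction, provided that it is sense-preserving for all averages of the derivatives and that the
derivative of its imaginary part along vertical lines is positive. -/
theorem combination_shear_of_strip {I : Set ℝ} (hI : IsOpen I) (hIc : I.OrdConnected)
    (hIne : I.Nonempty) {q₁ q₂ : ℂ → ℂ} {η C : ℂ} {K₁ K₂ : Set ℂ}
    (hq₁ : DifferentiableOn ℂ q₁ (Complex.re ⁻¹' I))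
    (hq₂ : DifferentiableOn ℂ q₂ (Complex.re ⁻¹' I))
    (hK₁ : Convex ℝ K₁) (hK₁o : IsOpen K₁) (hK₂ : Convex ℝ K₂) (hK₂o : IsOpen K₂)
    (hqK₁ : ∀ w ∈ Complex.re ⁻¹' I, deriv q₁ w ∈ K₁)
    (hqK₂ : ∀ w ∈ Complex.re ⁻¹' I, deriv q₂ w ∈ K₂)
    (hK : ∀ A₁ ∈ K₁, ∀ A₂ ∈ K₂,
      ‖1 - A₂ - starRingEnd ℂ η * (A₁ - A₂)‖ < ‖1 + A₂ + η * (A₁ - A₂)‖)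
    (hpos : ∀ w ∈ Complex.re ⁻¹' I,
      0 < η.re * (deriv q₁ w).re + (1 - η.re) * (deriv q₂ w).re) :
    let T := fun w => η * shear C q₁ w + (1 - η) * shear C q₂ w
    InjOn T (Complex.re ⁻¹' I) ∧ IsOpen (T '' (Complex.re ⁻¹' I)) ∧
      IsConnected (T '' (Complex.re ⁻¹' I)) ∧
      ∀ c : ℝ, IsPreconnected (T '' (Complex.re ⁻¹' I) ∩ {p | p.im = c}) := by
  intro T
  have hS := isOpen_strip hI
  have hSc := convex_strip hIc
  set S := Complex.re ⁻¹' I with hSdef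
  set H : ℂ → ℂ := fun w => (w + C + (q₂ w + η * (q₁ w - q₂ w))) / 2 with hH
  -- The factor η multiplies conj g₁ - conj g₂, so it enters the co-analytic part as its conjugate.
  set G : ℂ → ℂ := fun w => (w + C - (q₂ w + starRingEnd ℂ η * (q₁ w - q₂ w))) / 2 with hG
  have hT : T = fun w => H w + starRingEnd ℂ (G w) := by
    funext w
    simp only [T, shear, hH, hG, map_div₀, map_sub, map_add, map_mul, Complex.conj_conj,
      map_ofNat]
    ring
  have hHd : DifferentiableOn ℂ H S := by fun_prop
  have hGd : DifferentiableOn ℂ G S := by fun_prop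
  have hTc : ContinuousOn T S := by
    rw [hT]
    exact hHd.continuousOn.add (Complex.continuous_conj.comp_continuousOn hGd.continuousOn)
  have hSne : S.Nonempty := by
    obtain ⟨x, hx⟩ := hIne
    exact ⟨(x : ℂ), by simpa [hSdef] using hx⟩
  refine ⟨?_, ?_, ?_, ?_⟩
  · intro w hw w' hw' heq
    by_contra hne
    -- The two slopes are unrelated averages, which is why `hK` is required for independent A₁ and
    -- A₂.
    obtain ⟨A₁, hA₁, h₁⟩ := exists_slope_mem hS hSc hK₁ hK₁o hq₁ hqK₁ hw hw'
    obtain ⟨A₂, hA₂, h₂⟩ := exists_slope_mem hS hSc hK₂ hK₂o hq₂ hqK₂ hw hw'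
    have hHs : H w' - H w = (w' - w) * (1 + A₂ + η * (A₁ - A₂)) / 2 := by
      simp only [hH]
      linear_combination (1 - η) / 2 * h₂ + η / 2 * h₁
    have hGs : G w' - G w = (w' - w) * (1 - A₂ - starRingEnd ℂ η * (A₁ - A₂)) / 2 := by
      simp only [hG]
      linear_combination -(1 - starRingEnd ℂ η) / 2 * h₂ - starRingEnd ℂ η / 2 * h₁
    have hnorm : ‖H w' - H w‖ = ‖G w' - G w‖ := by
      rw [hT] at heq
      have : H w' - H w = -starRingEnd ℂ (G w' - G w) := by
        rw [map_sub]
        linear_combination -heq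
      rw [this, norm_neg, RCLike.norm_conj]
    rw [hHs, hGs, norm_div, norm_div, norm_mul, norm_mul] at hnorm
    have hδ : 0 < ‖w' - w‖ := norm_pos_iff.mpr (sub_ne_zero.mpr (Ne.symm hne))
    have := mul_lt_mul_of_pos_left (hK A₁ hA₁ A₂ hA₂) hδ
    simp only [RCLike.norm_ofNat] at hnorm
    linarith
  · rw [hT]
    refine isOpen_image_add_conj hS hHd hGd fun w hw => ?_
    have h₁ := (hq₁.differentiableAt (hS.mem_nhds hw)).hasDerivAt
    have h₂ := (hq₂.differentiableAt (hS.mem_nhds hw)).hasDerivAt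
    have hH' : deriv H w = (1 + (deriv q₂ w + η * (deriv q₁ w - deriv q₂ w))) / 2 :=
      ((((hasDerivAt_id w).add_const C).add (h₂.add ((h₁.sub h₂).const_mul η))).div_const 2).deriv
    have hG' : deriv G w =
        (1 - (deriv q₂ w + starRingEnd ℂ η * (deriv q₁ w - deriv q₂ w))) / 2 :=
      ((((hasDerivAt_id w).add_const C).sub
        (h₂.add ((h₁.sub h₂).const_mul (starRingEnd ℂ η)))).div_const 2).deriv
    rw [hH', hG', norm_div, norm_div]
    have := hK _ (hqK₁ w hw) _ (hqK₂ w hw)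
    rw [sub_sub, add_assoc] at this
    exact div_lt_div_of_pos_right this (by simp)
  · exact (hSc.isConnected hSne).image T hTc
  · intro c
    set Q : ℂ → ℂ := fun w => (η.re : ℂ) * q₁ w + ((1 - η.re : ℝ) : ℂ) * q₂ w with hQ
    have hQd : DifferentiableOn ℂ Q S := by fun_prop
    have hQpos : ∀ w ∈ S, 0 < (deriv Q w).re := fun w hw => by
      have h₁ := (hq₁.differentiableAt (hS.mem_nhds hw)).hasDerivAt
      have h₂ := (hq₂.differentiableAt (hS.mem_nhds hw)).hasDerivAt
      have hQ' : deriv Q w = (η.re : ℂ) * deriv q₁ w + ((1 - η.re : ℝ) : ℂ) * deriv q₂ w :=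
        ((h₁.const_mul (η.re : ℂ)).add (h₂.const_mul ((1 - η.re : ℝ) : ℂ))).deriv
      rw [hQ', Complex.add_re, Complex.re_ofReal_mul, Complex.re_ofReal_mul]
      exact hpos w hw
    -- A shear equals Re(w + C) + i Im q, so two shears differ by an imaginary number and Im η
    -- affects only the real part of T.
    have hIm : ∀ w, (T w).im = (Q w).im := fun w => by
      have hTw : T w = ((w.re + C.re : ℝ) : ℂ) + ((q₂ w).im : ℝ) * Complex.I
          + η * (((q₁ w).im - (q₂ w).im : ℝ) * Complex.I) := by
        have e₁ := Complex.sub_conj (q₁ w)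
        have e₂ := Complex.sub_conj (q₂ w)
        have e₃ := Complex.add_conj w
        have e₄ := Complex.add_conj C
        simp only [T, shear, map_div₀, map_sub, map_add, map_ofNat]
        push_cast at e₁ e₂ e₃ e₄ ⊢
        linear_combination (e₃ + e₄ + e₂ + η * (e₁ - e₂)) / 2
      rw [hTw]
      simp [hQ]
      ring
    have himage : T '' S ∩ {p | p.im = c} = T '' {w | w.re ∈ I ∧ (Q w).im = c} := by
      ext p
      constructor
      · rintro ⟨⟨w, hw, rfl⟩, hc⟩
        exact ⟨w, ⟨hw, (hIm w).symm.trans hc⟩, rfl⟩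
      · rintro ⟨w, ⟨hw, hc⟩, rfl⟩
        exact ⟨⟨w, hw, rfl⟩, (hIm w).trans hc⟩
    rw [himage]
    exact (isPreconnected_level hI hIc hQd hQpos c).image T (hTc.mono fun w hw => hw.1)

/-! ### Cayley images of the dilatation disks -/

/-- The image of the disk `|ω| < α` under `ω ↦ (1 - ω) / (1 + ω)`. -/
def cayleyDisk (α : ℝ) : Set ℂ := {A | ‖1 - A‖ < α * ‖1 + A‖}

theorem isOpen_cayleyDisk (α : ℝ) : IsOpen (cayleyDisk α) :=
  isOpen_lt (by fun_prop) (by fun_prop)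

theorem mem_cayleyDisk_iff {α : ℝ} (hα : 0 ≤ α) {A : ℂ} :
    A ∈ cayleyDisk α ↔
      (1 - α ^ 2) * (A.re ^ 2 + A.im ^ 2 + 1) < 2 * (1 + α ^ 2) * A.re := by
  rw [cayleyDisk, mem_ofPred_eq, ← sq_lt_sq₀ (norm_nonneg _) (by positivity), mul_pow,
    Complex.sq_norm, Complex.sq_norm, Complex.normSq_apply, Complex.normSq_apply]
  simp only [Complex.sub_re, Complex.sub_im, Complex.add_re, Complex.add_im, Complex.one_re,
    Complex.one_im]
  constructor <;> intro h <;> nlinarith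

/-- The squared condition bounds a convex function of A, since 1 - α² ≥ 0; the set is a disk for 0 <
α < 1 and the right half-plane for α = 1. -/
theorem convex_cayleyDisk {α : ℝ} (hα : 0 ≤ α) (hα1 : α ≤ 1) : Convex ℝ (cayleyDisk α) := by
  have hα2 : 0 ≤ 1 - α ^ 2 := by nlinarith
  intro A hA B hB s t hs ht hst
  rw [mem_cayleyDisk_iff hα] at *
  obtain rfl : t = 1 - s := by linarith
  simp only [Complex.add_re, Complex.add_im, Complex.real_smul, Complex.re_ofReal_mul,
    Complex.im_ofReal_mul]
  have h1 : 0 ≤ (1 - α ^ 2) * (s * (1 - s) * ((A.re - B.re) ^ 2 + (A.im - B.im) ^ 2)) := by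
    positivity
  rcases hs.eq_or_lt with rfl | hs
  · simpa using hB
  · nlinarith [mul_lt_mul_of_pos_left hA hs, mul_le_mul_of_nonneg_left hB.le ht]

theorem re_pos_of_mem_cayleyDisk {α : ℝ} (hα : 0 ≤ α) (hα1 : α ≤ 1) {A : ℂ}
    (hA : A ∈ cayleyDisk α) : 0 < A.re := by
  rw [mem_cayleyDisk_iff hα] at hA
  have hα2 : 0 ≤ 1 - α ^ 2 := by nlinarith
  have : 0 ≤ (1 - α ^ 2) * (A.re ^ 2 + A.im ^ 2 + 1) := by positivity
  by_contra! h
  nlinarith [mul_nonneg (by positivity : 0 ≤ 2 * (1 + α ^ 2)) (neg_nonneg.mpr h)]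

theorem re_bounds_of_mem_cayleyDisk {α : ℝ} (hα : 0 ≤ α) (hα1 : α < 1) {A : ℂ}
    (hA : A ∈ cayleyDisk α) :
    (1 - α) / (1 + α) < A.re ∧ A.re < (1 + α) / (1 - α) := by
  rw [mem_cayleyDisk_iff hα] at hA
  have h1 : 0 < 1 - α := by linarith
  have h2 : 0 < 1 + α := by linarith
  have hlt : ((1 + α) * A.re - (1 - α)) * ((1 - α) * A.re - (1 + α)) < 0 := by
    nlinarith [mul_nonneg (mul_pos h1 h2).le (sq_nonneg A.im)]
  rw [div_lt_iff₀ h2, lt_div_iff₀ h1]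
  rcases mul_neg_iff.mp hlt with ⟨h, h'⟩ | ⟨h, h'⟩
  · constructor <;> linarith
  · exfalso
    nlinarith

/-- By the triangle inequality it suffices that |1 - A₂| + 2|η||A₁ - A₂| < |1 + A₂|. As |1 - A₂| <
α₂|1 + A₂|, this leaves a margin (1 - α₂)|1 + A₂|, which `hηD` shows is enough. -/
theorem norm_lt_of_mem_cayleyDisk {α₁ α₂ : ℝ} (hα₁ : 0 < α₁) (hα₂ : 0 < α₂)
    (hα₂1 : α₂ < 1) {η : ℂ} (hη : ‖η‖ ≤ (1 - α₁) * (1 - α₂) / (2 * (α₁ + α₂))) {A₁ A₂ : ℂ}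
    (hA₁ : A₁ ∈ cayleyDisk α₁) (hA₂ : A₂ ∈ cayleyDisk α₂) :
    ‖1 - A₂ - starRingEnd ℂ η * (A₁ - A₂)‖ < ‖1 + A₂ + η * (A₁ - A₂)‖ := by
  rw [cayleyDisk, mem_ofPred_eq] at hA₁ hA₂
  rw [le_div_iff₀ (by positivity)] at hη
  have hX₁ : (1 - α₁) * ‖1 + A₁‖ ≤ 2 := by
    have : ‖(1 + A₁) + (1 - A₁)‖ = 2 := by
      rw [show (1 + A₁) + (1 - A₁) = 2 by ring, RCLike.norm_ofNat]
    have h := norm_sub_le_norm_add (1 + A₁) (1 - A₁)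
    linarith
  have hD : 2 * ‖A₁ - A₂‖ ≤ (α₁ + α₂) * (‖1 + A₁‖ * ‖1 + A₂‖) := by
    calc 2 * ‖A₁ - A₂‖ = ‖(1 + A₁) * (1 - A₂) - (1 + A₂) * (1 - A₁)‖ := by
          rw [show (1 + A₁) * (1 - A₂) - (1 + A₂) * (1 - A₁) = 2 * (A₁ - A₂) by ring, norm_mul,
            RCLike.norm_ofNat]
      _ ≤ ‖1 + A₁‖ * ‖1 - A₂‖ + ‖1 + A₂‖ * ‖1 - A₁‖ := by
          rw [← norm_mul, ← norm_mul]
          exact norm_sub_le _ _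
      _ ≤ ‖1 + A₁‖ * (α₂ * ‖1 + A₂‖) + ‖1 + A₂‖ * (α₁ * ‖1 + A₁‖) := by gcongr
      _ = _ := by ring
  have hηD : 2 * (‖η‖ * ‖A₁ - A₂‖) ≤ (1 - α₂) * ‖1 + A₂‖ := by
    calc 2 * (‖η‖ * ‖A₁ - A₂‖) = ‖η‖ * (2 * ‖A₁ - A₂‖) := by ring
      _ ≤ ‖η‖ * ((α₁ + α₂) * (‖1 + A₁‖ * ‖1 + A₂‖)) := by gcongr
      _ = ‖η‖ * (2 * (α₁ + α₂)) * (‖1 + A₁‖ * ‖1 + A₂‖ / 2) := by ring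
      _ ≤ (1 - α₁) * (1 - α₂) * (‖1 + A₁‖ * ‖1 + A₂‖ / 2) := by gcongr
      _ = (1 - α₁) * ‖1 + A₁‖ * ((1 - α₂) * ‖1 + A₂‖ / 2) := by ring
      _ ≤ 2 * ((1 - α₂) * ‖1 + A₂‖ / 2) := by
          have : 0 ≤ 1 - α₂ := by linarith
          gcongr
      _ = _ := by ring
  have h1 := norm_sub_le (1 - A₂) (starRingEnd ℂ η * (A₁ - A₂))
  have h2 := norm_sub_norm_le (1 + A₂) (-(η * (A₁ - A₂)))
  rw [norm_mul, RCLike.norm_conj] at h1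
  rw [norm_neg, norm_mul, sub_neg_eq_add] at h2
  linarith

/-! ### Strip coordinates on the disk -/

/-- Here 1 - 2cz + z² = (c - z)², so w = 1/(c - z) is a primitive of the reciprocal; it maps the
disk to the half-plane Re(cw) > 1/2. -/
theorem exists_strip_param_of_sq_eq_one {c : ℝ} (hc : c ^ 2 = 1) :
    ∃ (I : Set ℝ) (Θ : ℂ → ℂ), IsOpen I ∧ I.OrdConnected ∧ I.Nonempty ∧
      (∀ w ∈ Complex.re ⁻¹' I, HasDerivAt Θ (1 - 2 * Θ w * c + Θ w ^ 2) w) ∧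
      MapsTo Θ (Complex.re ⁻¹' I) disk ∧ SurjOn Θ (Complex.re ⁻¹' I) disk := by
  have hcC : (c : ℂ) ^ 2 = 1 := by exact_mod_cast hc
  have hne : ∀ w ∈ Complex.re ⁻¹' {x : ℝ | 1 / 2 < c * x}, w ≠ 0 := by
    rintro w hw rfl
    norm_num at hw
  refine ⟨{x | 1 / 2 < c * x}, fun w => c - w⁻¹, isOpen_lt (by fun_prop) (by fun_prop), ?_,
    ⟨c, ?_⟩, ?_, ?_, ?_⟩
  · exact (convex_halfSpace_gt (f := fun x : ℝ => c * x)
      ⟨fun x y => mul_add c x y, fun s x => by simp; ring⟩ _).ordConnected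
  · show 1 / 2 < c * c
    nlinarith
  · intro w hw
    refine ((hasDerivAt_inv (hne w hw)).const_sub (c : ℂ)).congr_deriv ?_
    field_simp [hne w hw]
    linear_combination w ^ 2 * hcC
  · intro w hw
    have hw0 := norm_pos_iff.mpr (hne w hw)
    have : (c : ℂ) - w⁻¹ = (c * w - 1) / w := by field_simp [hne w hw]
    show (c : ℂ) - w⁻¹ ∈ ball (0 : ℂ) 1
    rw [mem_ball_zero_iff, this, norm_div, div_lt_one hw0, ← sq_lt_sq₀ (norm_nonneg _)
      hw0.le, Complex.sq_norm, Complex.sq_norm, Complex.normSq_apply, Complex.normSq_apply]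
    have hw' : 1 / 2 < c * w.re := hw
    simp only [Complex.sub_re, Complex.sub_im, Complex.re_ofReal_mul, Complex.im_ofReal_mul,
      Complex.one_re, Complex.one_im]
    linear_combination 2 * hw' + (w.re ^ 2 + w.im ^ 2) * hc
  · intro z hz
    have hz1 : z.re ^ 2 + z.im ^ 2 < 1 := by
      rw [mem_ball_zero_iff, ← sq_lt_one_iff₀ (norm_nonneg _), Complex.sq_norm,
        Complex.normSq_apply] at hz
      linarith
    have hcz : (c : ℂ) - z ≠ 0 := by
      rw [sub_ne_zero]
      rintro rfl
      simp [hc] at hz1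
    refine ⟨((c : ℂ) - z)⁻¹, ?_, by simp⟩
    show 1 / 2 < c * (((c : ℂ) - z)⁻¹).re
    rw [Complex.inv_re, ← mul_div_assoc, lt_div_iff₀ (Complex.normSq_pos.mpr hcz),
      Complex.normSq_apply]
    simp
    nlinarith

/-- With e = c + is on the unit circle, N ↦ (e - N)/(1 - Ne) is an involution exchanging the upper
half-plane and the disk, and N = exp(2isw) maps the strip 0 < Re w < π/(2s) onto the upper
half-plane. -/
theorem exists_strip_param_of_sq_lt_one {c : ℝ} (hc : c ^ 2 < 1) :
    ∃ (I : Set ℝ) (Θ : ℂ → ℂ), IsOpen I ∧ I.OrdConnected ∧ I.Nonempty ∧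
      (∀ w ∈ Complex.re ⁻¹' I, HasDerivAt Θ (1 - 2 * Θ w * c + Θ w ^ 2) w) ∧
      MapsTo Θ (Complex.re ⁻¹' I) disk ∧ SurjOn Θ (Complex.re ⁻¹' I) disk := by
  obtain ⟨s, hs, hcs⟩ : ∃ s : ℝ, 0 < s ∧ c ^ 2 + s ^ 2 = 1 :=
    ⟨√(1 - c ^ 2), Real.sqrt_pos.mpr (by linarith), by rw [Real.sq_sqrt (by linarith)]; ring⟩
  set e : ℂ := ⟨c, s⟩ with he
  have hes : e ^ 2 - 1 = 2 * Complex.I * s * e := by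
    apply Complex.ext <;> simp [he, pow_two]
    · nlinarith
    · ring
  have hec : e ^ 2 + 1 = 2 * c * e := by
    apply Complex.ext <;> simp [he, pow_two]
    · nlinarith
    · ring
  have hsC : (s : ℂ) ≠ 0 := by exact_mod_cast hs.ne'
  have he0 : e ≠ 0 := fun h => hs.ne' (congrArg Complex.im h)
  have he1 : 1 - e ^ 2 ≠ 0 := by
    rw [← neg_sub, hes]
    simp [hsC, he0]
  have hden : ∀ N : ℂ, 0 < N.im → 1 - N * e ≠ 0 := by
    intro N hN h
    have hre := congrArg Complex.re h
    have him := congrArg Complex.im h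
    simp [he] at hre him
    have : N.im = -s := by linear_combination -N.im * hcs + s * hre - c * him
    linarith
  have hNim : ∀ w ∈ Complex.re ⁻¹' Ioo 0 (Real.pi / (2 * s)),
      0 < (Complex.exp (2 * Complex.I * s * w)).im := by
    rintro w ⟨hw0, hw1⟩
    rw [Complex.exp_im]
    rw [lt_div_iff₀ (by positivity)] at hw1
    have : (2 * Complex.I * s * w).im = w.re * (2 * s) := by
      simp
      ring
    rw [this]
    exact mul_pos (Real.exp_pos _) (Real.sin_pos_of_pos_of_lt_pi (by positivity) hw1)
  refine ⟨Ioo 0 (Real.pi / (2 * s)), fun w => (e - Complex.exp (2 * Complex.I * s * w)) /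
    (1 - Complex.exp (2 * Complex.I * s * w) * e), isOpen_Ioo, ordConnected_Ioo,
    nonempty_Ioo.mpr (by positivity), ?_, ?_, ?_⟩
  · intro w hw
    have hd := hden _ (hNim w hw)
    have hN : HasDerivAt (fun w => Complex.exp (2 * Complex.I * s * w))
        (Complex.exp (2 * Complex.I * s * w) * (2 * Complex.I * s)) w := by
      simpa using ((hasDerivAt_id w).const_mul (2 * Complex.I * (s : ℂ))).cexp
    refine ((hN.const_sub e).div ((hN.mul_const e).const_sub 1) hd).congr_deriv ?_
    beta_reduce
    set N := Complex.exp (2 * Complex.I * s * w)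
    have hs2 : (2 * Complex.I * s) * e = e ^ 2 - 1 := hes.symm
    have hkey : e * (N * (2 * Complex.I * s) * (e ^ 2 - 1)) =
        e * ((1 - N * e) ^ 2 - 2 * (e - N) * c * (1 - N * e) + (e - N) ^ 2) := by
      linear_combination N * (e ^ 2 - 1) * hs2 - (e - N) * (1 - N * e) * hec
    have hkey' := mul_left_cancel₀ he0 hkey
    -- An opaque name keeps the denominator atomic for `field_simp`.
    obtain ⟨d, hdN⟩ : ∃ d, d = 1 - N * e := ⟨_, rfl⟩
    rw [← hdN] at hd hkey' ⊢
    field_simp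
    rw [hdN] at hkey' ⊢
    linear_combination hkey'
  · intro w hw
    have hd := norm_pos_iff.mpr (hden _ (hNim w hw))
    have him := hNim w hw
    rw [mem_ball_zero_iff, norm_div, div_lt_one hd, ← sq_lt_sq₀ (norm_nonneg _) hd.le,
      Complex.sq_norm, Complex.sq_norm, Complex.normSq_apply, Complex.normSq_apply]
    set N := Complex.exp (2 * Complex.I * s * w)
    simp [he]
    -- |1 - Ne|² - |e - N|² = 4s Im N, because |e| = 1.
    linear_combination 4 * s * him + (1 - N.re ^ 2 - N.im ^ 2) * hcs
  · intro z hz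
    have hz1 : z.re ^ 2 + z.im ^ 2 < 1 := by
      rw [mem_ball_zero_iff, ← sq_lt_one_iff₀ (norm_nonneg _), Complex.sq_norm,
        Complex.normSq_apply] at hz
      linarith
    have hze : 1 - z * e ≠ 0 := by
      intro h
      have h1 := congrArg Complex.normSq (sub_eq_zero.mp h)
      rw [map_mul, Complex.normSq_apply z, Complex.normSq_apply e] at h1
      simp [he] at h1
      nlinarith
    set N : ℂ := (e - z) / (1 - z * e) with hN
    have hNpos : 0 < N.im := by
      rw [hN, Complex.div_im, ← sub_div]
      refine div_pos ?_ (Complex.normSq_pos.mpr hze)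
      simp [he]
      linear_combination s * hz1 - z.im * hcs
    have hN0 : N ≠ 0 := by
      rintro h
      simp [h] at hNpos
    refine ⟨Complex.log N / (2 * Complex.I * s), ?_, ?_⟩
    · have hre : (Complex.log N / (2 * Complex.I * s)).re = N.arg / (2 * s) := by
        rw [show Complex.log N / (2 * Complex.I * s) =
          ((1 / (2 * s) : ℝ) : ℂ) * (-Complex.I * Complex.log N) by
            push_cast; field_simp; simp, Complex.re_ofReal_mul]
        simp [Complex.log_im]
        ring
      rw [mem_preimage, hre]
      have h0 : 0 < N.arg := lt_of_le_of_ne (Complex.arg_nonneg_iff.mpr hNpos.le) fun h =>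
        hNpos.ne' (Complex.arg_eq_zero_iff.mp h.symm).2
      have hpi : N.arg < Real.pi := Complex.arg_lt_pi_iff.mpr (Or.inr hNpos.ne')
      exact ⟨by positivity, div_lt_div_of_pos_right hpi (by positivity)⟩
    · have h2 : 2 * Complex.I * s * (Complex.log N / (2 * Complex.I * s)) = Complex.log N := by
        field_simp
      have hd := hden N hNpos
      simp only [h2, Complex.exp_log hN0]
      rw [div_eq_iff hd, hN]
      obtain ⟨d, hdz⟩ : ∃ d, d = 1 - z * e := ⟨_, rfl⟩
      rw [← hdz] at hze ⊢
      field_simp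
      rw [hdz]
      ring

theorem exists_strip_param {c : ℝ} (hc : c ^ 2 ≤ 1) :
    ∃ (I : Set ℝ) (Θ : ℂ → ℂ), IsOpen I ∧ I.OrdConnected ∧ I.Nonempty ∧
      (∀ w ∈ Complex.re ⁻¹' I, HasDerivAt Θ (1 - 2 * Θ w * c + Θ w ^ 2) w) ∧
      MapsTo Θ (Complex.re ⁻¹' I) disk ∧ SurjOn Θ (Complex.re ⁻¹' I) disk :=
  hc.lt_or_eq.elim exists_strip_param_of_sq_lt_one exists_strip_param_of_sq_eq_one

theorem psi_denominator_ne_zero (ν : ℝ) {z : ℂ} (hz : z ∈ disk) :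
    1 - 2 * z * (Real.cos ν : ℂ) + z ^ 2 ≠ 0 := by
  have hfac : 1 - 2 * z * (Real.cos ν : ℂ) + z ^ 2 =
      (1 - z * Complex.exp (ν * Complex.I)) * (1 - z * Complex.exp (-ν * Complex.I)) := by
    have h1 : Complex.exp (ν * Complex.I) * Complex.exp (-ν * Complex.I) = 1 := by
      rw [← Complex.exp_add]
      simp
    rw [Complex.ofReal_cos, Complex.cos]
    linear_combination -z ^ 2 * h1
  have hne : ∀ t : ℝ, 1 - z * Complex.exp (t * Complex.I) ≠ 0 := fun t h => by
    have := congrArg norm (sub_eq_zero.mp h)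
    rw [norm_mul, Complex.norm_exp_ofReal_mul_I, norm_one, mul_one] at this
    rw [mem_ball_zero_iff] at hz
    linarith
  rw [hfac]
  exact mul_ne_zero (hne ν) (by simpa using hne (-ν))

theorem psi_eq (μ ν : ℝ) (z : ℂ) :
    psi μ ν z = (1 - 2 * (Complex.exp (μ * Complex.I) * z) * (Real.cos ν : ℂ)
      + (Complex.exp (μ * Complex.I) * z) ^ 2)⁻¹ := by
  have h : Complex.exp (2 * μ * Complex.I) = Complex.exp (μ * Complex.I) ^ 2 := by
    rw [← Complex.exp_nat_mul]
    push_cast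
    ring_nf
  rw [psi, h]
  congr 1
  ring

theorem exp_mul_mem_disk (μ : ℝ) {z : ℂ} (hz : z ∈ disk) :
    Complex.exp (μ * Complex.I) * z ∈ disk := by
  rw [mem_ball_zero_iff] at *
  rwa [norm_mul, Complex.norm_exp_ofReal_mul_I, one_mul]

theorem hasDerivAt_integralFromZero {F : ℂ → ℂ} (hF : DifferentiableOn ℂ F disk) {z : ℂ}
    (hz : z ∈ disk) : HasDerivAt (integralFromZero F) (F z) z := by
  obtain ⟨A, hA⟩ := hF.isExactOn_ball
  have heq : ∀ z ∈ disk, integralFromZero F z = A z - A 0 := by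
    intro z hz
    have hseg : ∀ t ∈ Icc (0 : ℝ) 1, 0 + t • z ∈ disk := fun t ht => by
      simpa using (convex_ball (0 : ℂ) 1).add_smul_sub_mem (mem_ball_self one_pos) hz ht
    have := intervalIntegral.integral_unitInterval_deriv_eq_sub (f := A) (f' := F)
      (hF.continuousOn.comp (by fun_prop) hseg) fun t ht => hA _ (hseg t ht)
    simp only [zero_add, Complex.real_smul, smul_eq_mul] at this
    rw [integralFromZero, ← this, intervalIntegral.integral_mul_const, mul_comm]
  refine ((hA z hz).sub_const (A 0)).congr_of_eventuallyEq ?_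
  filter_upwards [isOpen_ball.mem_nhds hz] with y hy using heq y hy

/-- A vertical strip (possibly a half-plane) is mapped onto the disk by a function inverse to
a translate of `e^{iμ} ∫ ψ_{μ,ν}`. -/
theorem exists_strip_param_psi (μ ν : ℝ) :
    ∃ (I : Set ℝ) (Θ : ℂ → ℂ) (C : ℂ), IsOpen I ∧ I.OrdConnected ∧ I.Nonempty ∧
      DifferentiableOn ℂ Θ (Complex.re ⁻¹' I) ∧
      MapsTo Θ (Complex.re ⁻¹' I) disk ∧ SurjOn Θ (Complex.re ⁻¹' I) disk ∧
      ∀ w ∈ Complex.re ⁻¹' I,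
        Complex.exp (μ * Complex.I) * integralFromZero (psi μ ν) (Θ w) = w + C := by
  obtain ⟨I, Θ, hI, hIc, hIne, hΘ, hmaps, hsurj⟩ := exists_strip_param (Real.cos_sq_le_one ν)
  have hS := isOpen_strip hI
  have hexp : Complex.exp (μ * Complex.I) * Complex.exp ((-μ : ℝ) * Complex.I) = 1 := by
    rw [← Complex.exp_add]
    simp
  have hcancel : ∀ z, Complex.exp (μ * Complex.I) * (Complex.exp ((-μ : ℝ) * Complex.I) * z) = z :=
    fun z => by rw [← mul_assoc, hexp, one_mul]
  have hpsi : DifferentiableOn ℂ (psi μ ν) disk := by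
    have : psi μ ν = fun z => (1 - 2 * (Complex.exp (μ * Complex.I) * z) * (Real.cos ν : ℂ)
      + (Complex.exp (μ * Complex.I) * z) ^ 2)⁻¹ := funext (psi_eq μ ν)
    rw [this]
    exact DifferentiableOn.inv (by fun_prop) fun z hz =>
      psi_denominator_ne_zero ν (exp_mul_mem_disk μ hz)
  have hmaps' : MapsTo (fun w => Complex.exp ((-μ : ℝ) * Complex.I) * Θ w)
      (Complex.re ⁻¹' I) disk := fun w hw => exp_mul_mem_disk (-μ) (hmaps hw)
  have hder : ∀ w ∈ Complex.re ⁻¹' I, HasDerivAt (fun w => Complex.exp (μ * Complex.I) *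
      integralFromZero (psi μ ν) (Complex.exp ((-μ : ℝ) * Complex.I) * Θ w) - w) 0 w := by
    intro w hw
    have h1 := (hasDerivAt_integralFromZero hpsi (hmaps' hw)).comp_of_eq w
      ((hΘ w hw).const_mul (Complex.exp ((-μ : ℝ) * Complex.I))) rfl
    refine ((h1.const_mul (Complex.exp (μ * Complex.I))).sub (hasDerivAt_id w)).congr_deriv ?_
    have hD := psi_denominator_ne_zero ν (hmaps hw)
    rw [psi_eq, hcancel, mul_left_comm (_ ⁻¹), hcancel, inv_mul_cancel₀ hD, sub_self]
  obtain ⟨C, hC⟩ := hS.exists_is_const_of_deriv_eq_zero (convex_strip hIc).isPreconnected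
    (fun w hw => (hder w hw).differentiableAt.differentiableWithinAt)
    (fun w hw => (hder w hw).deriv)
  refine ⟨I, fun w => Complex.exp ((-μ : ℝ) * Complex.I) * Θ w, C, hI, hIc, hIne,
    fun w hw => ((hΘ w hw).differentiableAt.const_mul _).differentiableWithinAt, hmaps', ?_, ?_⟩
  · intro z hz
    obtain ⟨w, hw, hwz⟩ := hsurj (exp_mul_mem_disk μ hz)
    refine ⟨w, hw, ?_⟩
    simp only [hwz]
    rw [mul_left_comm, hcancel]
  · intro w hw
    linear_combination hC w hw

/-! ### Passage between strip and disk -/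

/-- The shear representation of a normalized harmonic mapping in the strip coordinate. -/
theorem exists_shear_of_strip_param {μ : ℝ} {I : Set ℝ} {Θ Ψ f h g : ℂ → ℂ} {C : ℂ}
    (hI : IsOpen I) (hΘ : DifferentiableOn ℂ Θ (Complex.re ⁻¹' I))
    (hmaps : MapsTo Θ (Complex.re ⁻¹' I) disk)
    (hΨ : ∀ w ∈ Complex.re ⁻¹' I, Complex.exp (μ * Complex.I) * Ψ (Θ w) = w + C)
    (hf : IsNormalizedHarmonic f h g)
    (hshear : ∀ z ∈ disk, h z + Complex.exp (-2 * μ * Complex.I) * g z = Ψ z) :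
    ∃ q : ℂ → ℂ, DifferentiableOn ℂ q (Complex.re ⁻¹' I) ∧
      (∀ α : ℝ, (∀ z ∈ disk, ‖deriv g z‖ < α * ‖deriv h z‖) →
        ∀ w ∈ Complex.re ⁻¹' I, deriv q w ∈ cayleyDisk α) ∧
      ∀ w ∈ Complex.re ⁻¹' I, Complex.exp (μ * Complex.I) * f (Θ w) = shear C q w := by
  have hS := isOpen_strip hI
  set u : ℂ := Complex.exp (μ * Complex.I) with hu
  have hu1 : ‖u‖ = 1 := Complex.norm_exp_ofReal_mul_I μ
  have huu : u * starRingEnd ℂ u = 1 := by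
    rw [Complex.mul_conj, Complex.normSq_eq_norm_sq, hu1]
    simp
  -- The analytic and co-analytic parts of uf are uh and conj(u)g; this identity turns the
  -- hypothesis on h and g into a statement about their sum.
  have hu2 : u * Complex.exp (-2 * μ * Complex.I) = starRingEnd ℂ u := by
    rw [hu, ← Complex.exp_add, ← Complex.exp_conj]
    congr 1
    simp only [map_mul, Complex.conj_ofReal, Complex.conj_I]
    ring
  have hsum : ∀ w ∈ Complex.re ⁻¹' I, u * h (Θ w) + starRingEnd ℂ u * g (Θ w) = w + C :=
    fun w hw => by
      rw [← hΨ w hw, ← hshear _ (hmaps hw), ← hu2]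
      ring
  have hh : ∀ w ∈ Complex.re ⁻¹' I,
      HasDerivAt (fun w => u * h (Θ w)) (u * (deriv h (Θ w) * deriv Θ w)) w := fun w hw =>
    ((hf.analytic_h.differentiableAt (isOpen_ball.mem_nhds (hmaps hw))).hasDerivAt.comp w
      (hΘ.differentiableAt (hS.mem_nhds hw)).hasDerivAt).const_mul u
  have hg : ∀ w ∈ Complex.re ⁻¹' I, HasDerivAt (fun w => starRingEnd ℂ u * g (Θ w))
      (starRingEnd ℂ u * (deriv g (Θ w) * deriv Θ w)) w := fun w hw =>
    ((hf.analytic_g.differentiableAt (isOpen_ball.mem_nhds (hmaps hw))).hasDerivAt.comp w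
      (hΘ.differentiableAt (hS.mem_nhds hw)).hasDerivAt).const_mul _
  refine ⟨fun w => u * h (Θ w) - starRingEnd ℂ u * g (Θ w), fun w hw =>
    ((hh w hw).sub (hg w hw)).differentiableAt.differentiableWithinAt, ?_, ?_⟩
  · intro α hα w hw
    have hone : u * (deriv h (Θ w) * deriv Θ w) + starRingEnd ℂ u * (deriv g (Θ w) * deriv Θ w)
        = 1 := by
      refine ((hh w hw).add (hg w hw)).unique (((hasDerivAt_id w).add_const C).congr_of_eventuallyEq
        ?_)
      filter_upwards [hS.mem_nhds hw] with v hv using hsum v hv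
    have hΘ' : deriv Θ w ≠ 0 := fun h0 => by simp [h0] at hone
    have hq' : deriv (fun w => u * h (Θ w) - starRingEnd ℂ u * g (Θ w)) w =
        u * (deriv h (Θ w) * deriv Θ w) - starRingEnd ℂ u * (deriv g (Θ w) * deriv Θ w) :=
      ((hh w hw).sub (hg w hw)).deriv
    have h1 : 1 - (u * (deriv h (Θ w) * deriv Θ w) - starRingEnd ℂ u * (deriv g (Θ w) * deriv Θ w))
        = 2 * (starRingEnd ℂ u * (deriv g (Θ w) * deriv Θ w)) := by
      linear_combination -hone
    have h2 : 1 + (u * (deriv h (Θ w) * deriv Θ w) - starRingEnd ℂ u * (deriv g (Θ w) * deriv Θ w))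
        = 2 * (u * (deriv h (Θ w) * deriv Θ w)) := by
      linear_combination -hone
    rw [cayleyDisk, mem_ofPred_eq, hq', h1, h2]
    simp only [norm_mul, RCLike.norm_conj, hu1, RCLike.norm_ofNat, one_mul]
    have := mul_lt_mul_of_pos_right (hα _ (hmaps hw)) (norm_pos_iff.mpr hΘ')
    linarith
  · intro w hw
    rw [hf.decomposition _ (hmaps hw), shear, ← hsum w hw]
    simp only [map_div₀, map_sub, map_add, map_mul, Complex.conj_conj, map_ofNat]
    ring

/-- Transfer of univalence and horizontal convexity from the strip to the disk. -/
theorem univalentConvexInDirection_of_strip {μ : ℝ} {S : Set ℂ} {Θ F T : ℂ → ℂ}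
    (hmaps : MapsTo Θ S disk) (hsurj : SurjOn Θ S disk)
    (hT : ∀ w ∈ S, Complex.exp (μ * Complex.I) * F (Θ w) = T w)
    (hinj : InjOn T S) (hopen : IsOpen (T '' S)) (hconn : IsConnected (T '' S))
    (hlevel : ∀ c : ℝ, IsPreconnected (T '' S ∩ {p | p.im = c})) :
    UnivalentConvexInDirection F (-μ) := by
  set u : ℂ := Complex.exp (μ * Complex.I) with hu
  have hu0 : u ≠ 0 := Complex.exp_ne_zero _
  have hinv : Complex.exp ((-μ : ℝ) * Complex.I) = u⁻¹ := by
    rw [hu, ← Complex.exp_neg]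
    simp
  have himage : F '' disk = (fun p => u⁻¹ * p) '' (T '' S) := by
    rw [← hsurj.image_eq_of_mapsTo hmaps, image_image, image_image]
    exact image_congr fun w hw => by rw [← hT w hw, inv_mul_cancel_left₀ hu0]
  have hcont : Continuous fun p : ℂ => u⁻¹ * p := by fun_prop
  refine ⟨?_, ?_, ?_, ?_⟩
  · intro z hz z' hz' h
    obtain ⟨w, hw, rfl⟩ := hsurj hz
    obtain ⟨w', hw', rfl⟩ := hsurj hz'
    rw [hinj hw hw' (by rw [← hT w hw, ← hT w' hw', h])]
  · rw [himage]
    exact (Homeomorph.mulLeft₀ u⁻¹ (inv_ne_zero hu0)).isOpenMap _ hopen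
  · rw [himage]
    exact hconn.image _ hcont.continuousOn
  · intro v
    have hline : F '' disk ∩ lineInDirection (-μ) v =
        (fun p => u⁻¹ * p) '' (T '' S ∩ {p | p.im = (u * v).im}) := by
      rw [himage]
      ext p
      constructor
      · rintro ⟨⟨s, hs, rfl⟩, t, ht⟩
        refine ⟨s, ⟨hs, ?_⟩, rfl⟩
        rw [hinv] at ht
        have : s = u * v + t := by
          have := congrArg (fun p => u * p) ht
          simp only [mul_add, mul_inv_cancel_left₀ hu0, mul_left_comm u (t : ℂ),
            mul_inv_cancel₀ hu0, mul_one] at this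
          exact this
        simp [this]
      · rintro ⟨s, ⟨hs, hsc⟩, rfl⟩
        refine ⟨⟨s, hs, rfl⟩, s.re - (u * v).re, ?_⟩
        have : s = u * v + ((s.re - (u * v).re : ℝ) : ℂ) := by
          have hsc' : s.im = (u * v).im := hsc
          apply Complex.ext
          · simp
          · rw [Complex.add_im, Complex.ofReal_im, add_zero, hsc']
        rw [hinv]
        simp only
        nth_rewrite 1 [this]
        rw [mul_add, inv_mul_cancel_left₀ hu0, mul_comm u⁻¹]
    rw [hline]
    exact (hlevel _).image _ hcont.continuousOn

/-! ### Proof of the theorem -/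

/-- For a < 0 write the sum as -a(2 Re A₂ - Re A₁) + (1 + a) Re A₂. The thresholds 1/5 and 1/7 give
Re A₁ < 3/2 and Re A₂ > 3/4, just enough for a = -1. -/
theorem combination_re_pos {α₁ α₂ a : ℝ} (hα₁ : 0 < α₁) (hα₂ : 0 < α₂) {A₁ A₂ : ℂ}
    (h₁ : A₁ ∈ cayleyDisk 1) (h₂ : A₂ ∈ cayleyDisk 1) (h₁' : A₁ ∈ cayleyDisk α₁)
    (h₂' : A₂ ∈ cayleyDisk α₂)
    (ha : (0 ≤ a ∧ a ≤ 1) ∨ ((-1 ≤ a ∧ a ≤ 1) ∧ α₁ ≤ 1 / 5 ∧ α₂ ≤ 1 / 7)) :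
    0 < a * A₁.re + (1 - a) * A₂.re := by
  have hA₁ := re_pos_of_mem_cayleyDisk zero_le_one le_rfl h₁
  have hA₂ := re_pos_of_mem_cayleyDisk zero_le_one le_rfl h₂
  rcases le_total 0 a with ha0 | ha0
  · have ha1 : a ≤ 1 := ha.elim (fun h => h.2) fun h => h.1.2
    rcases ha0.eq_or_lt with rfl | ha0
    · simpa using hA₂
    · exact add_pos_of_pos_of_nonneg (mul_pos ha0 hA₁) (mul_nonneg (sub_nonneg.mpr ha1) hA₂.le)
  · rcases ha with ⟨ha, -⟩ | ⟨⟨ha, -⟩, hα₁5, hα₂7⟩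
    · obtain rfl : a = 0 := le_antisymm ha0 ha
      simpa using hA₂
    · have hu : A₁.re < 3 / 2 := by
        refine (re_bounds_of_mem_cayleyDisk hα₁.le (by linarith) h₁').2.trans_le ?_
        rw [div_le_iff₀ (by linarith)]
        linarith
      have hl : 3 / 4 < A₂.re := by
        refine lt_of_le_of_lt ?_ (re_bounds_of_mem_cayleyDisk hα₂.le (by linarith) h₂').1
        rw [le_div_iff₀ (by linarith)]
        linarith
      nlinarith [mul_nonneg (neg_nonneg.mpr ha0) (by linarith : 0 ≤ 2 * A₂.re - A₁.re),
        mul_nonneg (by linarith : 0 ≤ 1 + a) hA₂.le]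

theorem univalentConvexInDirection_combination {μ ν α₁ α₂ : ℝ} {f₁ h₁ g₁ f₂ h₂ g₂ : ℂ → ℂ}
    (hf₁ : IsNormalizedHarmonic f₁ h₁ g₁) (hf₂ : IsNormalizedHarmonic f₂ h₂ g₂)
    (hshear₁ : ∀ z ∈ disk, h₁ z + Complex.exp (-2 * μ * Complex.I) * g₁ z =
      integralFromZero (psi μ ν) z)
    (hshear₂ : ∀ z ∈ disk, h₂ z + Complex.exp (-2 * μ * Complex.I) * g₂ z =
      integralFromZero (psi μ ν) z)
    (hω₁ : ∀ z ∈ disk, ‖dilatation h₁ g₁ z‖ < α₁)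
    (hω₂ : ∀ z ∈ disk, ‖dilatation h₂ g₂ z‖ < α₂)
    (hα : α₁ ≤ 1 ∨ α₂ ≤ 1) {η : ℂ} (hη : ‖η‖ ≤ (1 - α₁) * (1 - α₂) / (2 * (α₁ + α₂)))
    (hre : (0 ≤ η.re ∧ η.re ≤ 1) ∨ ((-1 ≤ η.re ∧ η.re ≤ 1) ∧ α₁ ≤ 1 / 5 ∧ α₂ ≤ 1 / 7)) :
    UnivalentConvexInDirection (fun z => η * f₁ z + (1 - η) * f₂ z) (-μ) := by
  have h0 : (0 : ℂ) ∈ disk := mem_ball_self one_pos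
  have hα₁ : 0 < α₁ := (norm_nonneg _).trans_lt (hω₁ 0 h0)
  have hα₂ : 0 < α₂ := (norm_nonneg _).trans_lt (hω₂ 0 h0)
  have hone : ∀ {f h g : ℂ → ℂ}, IsNormalizedHarmonic f h g → ∀ z ∈ disk,
      ‖deriv g z‖ < 1 * ‖deriv h z‖ := fun hf z hz => by
    rw [one_mul, ← sq_lt_sq₀ (norm_nonneg _) (norm_nonneg _)]
    exact sub_pos.mp (hf.sensePreserving z hz)
  have hdil : ∀ {f h g : ℂ → ℂ} {α : ℝ}, IsNormalizedHarmonic f h g →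
      (∀ z ∈ disk, ‖dilatation h g z‖ < α) → ∀ z ∈ disk, ‖deriv g z‖ < α * ‖deriv h z‖ :=
    fun hf hω z hz => by
      have hpos := (norm_nonneg _).trans_lt (hone hf z hz)
      have := hω z hz
      rwa [dilatation, norm_div, div_lt_iff₀ (by linarith)] at this
  obtain ⟨I, Θ, C, hI, hIc, hIne, hΘ, hmaps, hsurj, hΨ⟩ := exists_strip_param_psi μ ν
  obtain ⟨q₁, hq₁, hqK₁, hfq₁⟩ := exists_shear_of_strip_param hI hΘ hmaps hΨ hf₁ hshear₁
  obtain ⟨q₂, hq₂, hqK₂, hfq₂⟩ := exists_shear_of_strip_param hI hΘ hmaps hΨ hf₂ hshear₂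
  have hpos : ∀ w ∈ Complex.re ⁻¹' I,
      0 < η.re * (deriv q₁ w).re + (1 - η.re) * (deriv q₂ w).re := fun w hw =>
    combination_re_pos hα₁ hα₂ (hqK₁ 1 (hone hf₁) w hw) (hqK₂ 1 (hone hf₂) w hw)
      (hqK₁ α₁ (hdil hf₁ hω₁) w hw) (hqK₂ α₂ (hdil hf₂ hω₂) w hw) hre
  have hT : ∀ w ∈ Complex.re ⁻¹' I, Complex.exp (μ * Complex.I) *
      (η * f₁ (Θ w) + (1 - η) * f₂ (Θ w)) = η * shear C q₁ w + (1 - η) * shear C q₂ w :=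
    fun w hw => by
      rw [← hfq₁ w hw, ← hfq₂ w hw]
      ring
  -- For η = 0 some α may be at least 1, so its set need not be convex; sense-preservation of f₂
  -- supplies the half-plane instead, and A₁ plays no role.
  rcases eq_or_ne η 0 with rfl | hη0
  · have hK : ∀ A₁ ∈ (univ : Set ℂ), ∀ A₂ ∈ cayleyDisk 1,
        ‖1 - A₂ - starRingEnd ℂ 0 * (A₁ - A₂)‖ < ‖1 + A₂ + 0 * (A₁ - A₂)‖ := by
      intro A₁ _ A₂ hA₂
      simpa [cayleyDisk] using hA₂
    obtain ⟨hinj, hopen, hconn, hlevel⟩ := combination_shear_of_strip (C := C) hI hIc hIne hq₁ hq₂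
      convex_univ isOpen_univ (convex_cayleyDisk zero_le_one le_rfl) (isOpen_cayleyDisk 1)
      (fun w _ => mem_univ _) (hqK₂ 1 (hone hf₂)) hK hpos
    exact univalentConvexInDirection_of_strip hmaps hsurj hT hinj hopen hconn hlevel
  · have hprod : 0 < (1 - α₁) * (1 - α₂) := by
      have := (norm_pos_iff.mpr hη0).trans_le hη
      exact (div_pos_iff_of_pos_right (by positivity)).mp this
    have hα₁1 : α₁ < 1 := by
      rcases hα with h | h <;> by_contra! h' <;> nlinarith
    have hα₂1 : α₂ < 1 := by nlinarith
    obtain ⟨hinj, hopen, hconn, hlevel⟩ := combination_shear_of_strip (C := C) hI hIc hIne hq₁ hq₂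
      (convex_cayleyDisk hα₁.le hα₁1.le) (isOpen_cayleyDisk α₁)
      (convex_cayleyDisk hα₂.le hα₂1.le) (isOpen_cayleyDisk α₂)
      (hqK₁ α₁ (hdil hf₁ hω₁)) (hqK₂ α₂ (hdil hf₂ hω₂))
      (fun A₁ hA₁ A₂ hA₂ => norm_lt_of_mem_cayleyDisk hα₁ hα₂ hα₂1 hη hA₁ hA₂) hpos
    exact univalentConvexInDirection_of_strip hmaps hsurj hT hinj hopen hconn hlevel

end HarmonicMapping

theorem mainTheorem1 (μ ν α₁ α₂ : ℝ) (f₁ h₁ g₁ f₂ h₂ g₂ : ℂ → ℂ)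
    (hf₁ : HarmonicMapping.IsNormalizedHarmonic f₁ h₁ g₁)
    (hf₂ : HarmonicMapping.IsNormalizedHarmonic f₂ h₂ g₂)
    (hshear₁ : ∀ z ∈ HarmonicMapping.disk,
      h₁ z + Complex.exp (-2 * μ * Complex.I) * g₁ z =
        HarmonicMapping.integralFromZero (HarmonicMapping.psi μ ν) z)
    (hshear₂ : ∀ z ∈ HarmonicMapping.disk,
      h₂ z + Complex.exp (-2 * μ * Complex.I) * g₂ z =
        HarmonicMapping.integralFromZero (HarmonicMapping.psi μ ν) z)
    (hω₁ : ∀ z ∈ HarmonicMapping.disk, ‖HarmonicMapping.dilatation h₁ g₁ z‖ < α₁)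
    (hω₂ : ∀ z ∈ HarmonicMapping.disk, ‖HarmonicMapping.dilatation h₂ g₂ z‖ < α₂)
    (hα : α₁ ≤ 1 ∨ α₂ ≤ 1) :
    (∀ η : ℂ, ‖η‖ ≤ (1 - α₁) * (1 - α₂) / (2 * (α₁ + α₂)) →
      ((0 ≤ η.re ∧ η.re ≤ 1) ∨
        ((-1 ≤ η.re ∧ η.re ≤ 1) ∧ α₁ ≤ 1 / 5 ∧ α₂ ≤ 1 / 7)) →
      HarmonicMapping.UnivalentConvexInDirection
        (fun z => η * f₁ z + (1 - η) * f₂ z) (-μ)) ∧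
    (α₁ ≤ 1 / 5 → α₂ ≤ 1 / 7 → ∀ η : ℂ, ‖η‖ ≤ 1 →
      HarmonicMapping.UnivalentConvexInDirection
        (fun z => η * f₁ z + (1 - η) * f₂ z) (-μ)) := by
  refine ⟨fun η hη hre => HarmonicMapping.univalentConvexInDirection_combination hf₁ hf₂
    hshear₁ hshear₂ hω₁ hω₂ hα hη hre, fun hα₁5 hα₂7 η hη => ?_⟩
  have h0 : (0 : ℂ) ∈ HarmonicMapping.disk := Metric.mem_ball_self one_pos
  have hα₁ : 0 < α₁ := (norm_nonneg _).trans_lt (hω₁ 0 h0)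
  have hα₂ : 0 < α₂ := (norm_nonneg _).trans_lt (hω₂ 0 h0)
  have habs := abs_le.mp ((Complex.abs_re_le_norm η).trans hη)
  refine HarmonicMapping.univalentConvexInDirection_combination hf₁ hf₂
    hshear₁ hshear₂ hω₁ hω₂ hα (hη.trans ?_) (Or.inr ⟨habs, hα₁5, hα₂7⟩)
  rw [le_div_iff₀ (by positivity)]
  -- The bound on |η| equals exactly 1 at α₁ = 1/5, α₂ = 1/7.
  nlinarith [mul_nonneg (sub_nonneg.mpr hα₁5) (sub_nonneg.mpr hα₂7)]
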